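/- Let $H$ be a complex Hilbert space and let $A$ be a JC-algebra on $H$, i.e. a norm-closed real linear space of self-adjoint bounded operators on $H$ that is closed under the Jordan product $a\circ b=\tfrac12(ab+ba)$. Put $U_ab=2a\circ(a\circ b)-(a\circ a)\circ b\ (=aba)$, let $A_+$ be the set of positive operators in $A$, and let $P(A)$ be the set of projections in $A$, ordered as operators. Assume that $A$ is an AJW-algebra, i.e. every set of pairwise orthogonal projections in $P(A)$ has a least upper bound in $P(A)$, and every maximal associative Jordan subalgebra $A_0$ of $A$ is the least norm-closed Jordan subalgebra containing $A_0\cap P(A)$. Assume also that $A$ is reversible: $a_1a_2\cdots a_n+a_n\cdots a_2a_1\in A$ for all $n\ge 1$ and $a_1,\dots,a_n\in A$. For a set $S$ of bounded operators let $R^*(S)$ and $C^*(S)$ be the norm-closed real $*$-algebra and the C$^*$-algebra generated by $S$ (no unit being adjoined), and for a set $S$ of self-adjoint operators let ${}^\perp(S)_+=\{x\in A_+ : U_ax=0 \text{ for all } a\in S\}$. Then $A$ has a unit $1$, the set $I=R^*(A)\cap iR^*(A)$ is a norm-closed two-sided ideal of $C^*(A)$ whose self-adjoint part $I_{sa}$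 is contained in $A$, and there are central projections $e,f$ of $A$ with $e+f=1$ such that $$eA_+={}^\perp\big({}^\perp(I_{sa})_+\big)_+\qquad\text{and}\qquad R^*(fA)\cap iR^*(fA)=\{0\}.$$ -/

import Mathlib

namespace JordanOp

variable {H : Type*} [NormedAddCommGroup H] [InnerProductSpace ℂ H] [CompleteSpace H]

/-- The Jordan product `a ∘ b = (ab + ba) / 2` of operators. -/
noncomputable def jmul (a b : H →L[ℂ] H) : H →L[ℂ] H := (1 / 2 : ℝ) • (a * b + b * a)

/-- The quadratic operator `U_a b = 2 a ∘ (a ∘ b) - (a ∘ a) ∘ b`. -/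
noncomputable def jU (a b : H →L[ℂ] H) : H →L[ℂ] H :=
  (2 : ℝ) • jmul a (jmul a b) - jmul (jmul a a) b

/-- A real linear space of operators that is closed under the Jordan product. -/
def IsJordanSubalgebra (A : Submodule ℝ (H →L[ℂ] H)) : Prop :=
  ∀ a ∈ A, ∀ b ∈ A, jmul a b ∈ A

/-- A JC-algebra on `H`: a norm-closed real Jordan algebra of self-adjoint bounded operators.
It need not contain the identity operator of `H`. -/
structure IsJCAlgebra (A : Submodule ℝ (H →L[ℂ] H)) : Prop where
  isSelfAdjoint : ∀ a ∈ A, IsSelfAdjoint a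
  jordan : IsJordanSubalgebra A
  isClosed : IsClosed (A : Set (H →L[ℂ] H))

/-- The set `P(A)` of projections of `A`; it is ordered by the usual order of operators. -/
def projections (A : Submodule ℝ (H →L[ℂ] H)) : Set (H →L[ℂ] H) :=
  {p | p ∈ A ∧ IsStarProjection p}

/-- `B` is an associative subalgebra of the Jordan algebra `A`. -/
def IsAssocSubalgebra (A B : Submodule ℝ (H →L[ℂ] H)) : Prop :=
  B ≤ A ∧ IsJordanSubalgebra B ∧
    ∀ a ∈ B, ∀ b ∈ B, ∀ c ∈ B, jmul (jmul a b) c = jmul a (jmul b c)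

/-- The least norm-closed Jordan subalgebra containing the set `S`. -/
noncomputable def closedJordanAdjoin (S : Set (H →L[ℂ] H)) : Submodule ℝ (H →L[ℂ] H) :=
  sInf {B | IsJordanSubalgebra B ∧ IsClosed (B : Set (H →L[ℂ] H)) ∧ S ⊆ B}

/-- An AJW-algebra on `H`: a JC-algebra in which every set of pairwise orthogonal projections has
a least upper bound in the poset of projections, and every maximal associative subalgebra is
generated, as a norm-closed subalgebra, by its projections. -/
structure IsAJWAlgebra (A : Submodule ℝ (H →L[ℂ] H)) : Prop extends IsJCAlgebra A where
  exists_isLUB : ∀ S : Set (projections A),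
    S.Pairwise (fun p q => (p : H →L[ℂ] H) * (q : H →L[ℂ] H) = 0) → ∃ p, IsLUB S p
  maximal_assoc : ∀ B : Submodule ℝ (H →L[ℂ] H), Maximal (IsAssocSubalgebra A) B →
    B = closedJordanAdjoin ((B : Set (H →L[ℂ] H)) ∩ projections A)

/-- `A` is reversible: `a₁a₂⋯aₙ + aₙ⋯a₂a₁ ∈ A` for all `a₁, …, aₙ ∈ A`, `n ≥ 1`. -/
def IsReversible (A : Submodule ℝ (H →L[ℂ] H)) : Prop :=
  ∀ l : List (H →L[ℂ] H), l ≠ [] → (∀ a ∈ l, a ∈ A) → l.prod + l.reverse.prod ∈ A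

/-- `R*(S)`: the norm-closed real `*`-algebra generated by `S`. -/
noncomputable def realStarAlg (S : Set (H →L[ℂ] H)) : NonUnitalStarSubalgebra ℝ (H →L[ℂ] H) :=
  (NonUnitalStarAlgebra.adjoin ℝ S).topologicalClosure

/-- `C*(S)`: the C*-algebra generated by `S`. -/
noncomputable def cStarAlg (S : Set (H →L[ℂ] H)) : NonUnitalStarSubalgebra ℂ (H →L[ℂ] H) :=
  (NonUnitalStarAlgebra.adjoin ℂ S).topologicalClosure

/-- `R*(S) ∩ iR*(S)`. -/
def realInterI (S : Set (H →L[ℂ] H)) : Set (H →L[ℂ] H) :=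
  (realStarAlg S : Set (H →L[ℂ] H)) ∩
    (fun x : H →L[ℂ] H => Complex.I • x) '' (realStarAlg S : Set (H →L[ℂ] H))

/-- `I` is a norm-closed two-sided ideal of the C*-algebra `C`. -/
structure IsClosedTwoSidedIdeal (C : NonUnitalStarSubalgebra ℂ (H →L[ℂ] H))
    (I : Submodule ℂ (H →L[ℂ] H)) : Prop where
  subset : ∀ x ∈ I, x ∈ C
  mul_left : ∀ c ∈ C, ∀ x ∈ I, c * x ∈ I
  mul_right : ∀ c ∈ C, ∀ x ∈ I, x * c ∈ I
  isClosed : IsClosed (I : Set (H →L[ℂ] H))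

/-- The self-adjoint part of a set of operators. -/
def saPart (S : Set (H →L[ℂ] H)) : Set (H →L[ℂ] H) := {x | x ∈ S ∧ IsSelfAdjoint x}

/-- The positive cone `A₊`. -/
def posCone (A : Submodule ℝ (H →L[ℂ] H)) : Set (H →L[ℂ] H) := {x | x ∈ A ∧ 0 ≤ x}

/-- `⊥(S)₊`: the positive `x ∈ A` with `U_a x = 0` for all `a ∈ S`. -/
def perpPos (A : Submodule ℝ (H →L[ℂ] H)) (S : Set (H →L[ℂ] H)) : Set (H →L[ℂ] H) :=
  {x | x ∈ posCone A ∧ ∀ a ∈ S, jU a x = 0}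

/-- `e` is a central projection of `A`. -/
def IsCentralProjection (A : Submodule ℝ (H →L[ℂ] H)) (e : H →L[ℂ] H) : Prop :=
  e ∈ projections A ∧ ∀ a ∈ A, Commute e a

/-- `u` is the unit element of the Jordan algebra `A`. -/
def IsJordanUnit (A : Submodule ℝ (H →L[ℂ] H)) (u : H →L[ℂ] H) : Prop :=
  u ∈ A ∧ ∀ a ∈ A, jmul u a = a

end JordanOp

namespace JordanOp

variable {H : Type*} [NormedAddCommGroup H] [InnerProductSpace ℂ H]

/-! Reversibility puts the self-adjoint part of `R*(A)`, hence `I_sa`, inside `A`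
(`IsReversible.mem_of_mem_realStarAlg`). Let `e` be the supremum of a maximal orthogonal family of
projections of `A` lying in `I`. The theorem follows once `e` is known to be central, to be a unit
for `I`, and to satisfy `x e = 0` whenever `x ∈ A₊` annihilates `I_sa`
(`IsAJWAlgebra.exists_central_cover`). Then `⊥(I_sa)₊` is the part of `A₊` killed by `e`, its
annihilator is `eA₊`, and an element of `R*(fA) ∩ iR*(fA)` lies in `I` yet is killed by `e`, so it
vanishes.

The tool behind these properties is `IsAJWAlgebra.exists_projection`: a nonzero `b ∈ A` has a
nonzero projection `q` in the closure of `bA`. Anything closed that holds for multiples of `b`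
(membership in `I`, orthogonality to `e`) passes to `q`, where it contradicts the maximality of the
family or the minimality of its supremum. -/

/-- A pairwise related subset of `Q` extends to a maximal one. -/
theorem exists_maximal_pairwise {α : Type*} (r : α → α → Prop) (Q S : Set α)
    (hS : S ⊆ Q) (hr : S.Pairwise r) :
    ∃ T, S ⊆ T ∧ Maximal (fun T : Set α => T ⊆ Q ∧ T.Pairwise r) T := by
  refine zorn_subset_nonempty {T : Set α | T ⊆ Q ∧ T.Pairwise r} ?_ S ⟨hS, hr⟩
  intro c hc hchain _
  refine ⟨⋃₀ c, ⟨Set.sUnion_subset fun s hs => (hc hs).1, ?_⟩, fun s hs => Set.subset_sUnion_of_mem hs⟩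
  exact (Set.pairwise_sUnion hchain.directedOn).2 fun s hs => (hc hs).2

/-! ### Algebraic identities and closed spans. -/

theorem jmul_eq_mul {a b : H →L[ℂ] H} (h : Commute a b) : jmul a b = a * b := by
  rw [jmul, ← h.eq, ← two_smul ℝ (a * b), smul_smul]
  norm_num

theorem jmul_self (a : H →L[ℂ] H) : jmul a a = a * a := jmul_eq_mul (Commute.refl a)

theorem jU_eq (a b : H →L[ℂ] H) : jU a b = a * b * a := by
  rw [jU, jmul_self]
  simp only [jmul, mul_add, add_mul, mul_smul_comm, smul_mul_assoc, smul_add, smul_smul, mul_assoc]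
  module

theorem mul_mem_span {P : Set (H →L[ℂ] H)} (hmul : ∀ p ∈ P, ∀ q ∈ P, p * q ∈ P) :
    ∀ a ∈ Submodule.span ℝ P, ∀ b ∈ Submodule.span ℝ P, a * b ∈ Submodule.span ℝ P := by
  intro a ha b hb
  induction ha, hb using Submodule.span_induction₂ with
  | mem_mem x y hx hy => exact Submodule.subset_span (hmul x hx y hy)
  | zero_left y hy => simp
  | zero_right x hx => simp
  | add_left x y z hx hy hz h1 h2 => rw [add_mul]; exact add_mem h1 h2
  | add_right x y z hx hy hz h1 h2 => rw [mul_add]; exact add_mem h1 h2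
  | smul_left r x y hx hy h => rw [smul_mul_assoc]; exact Submodule.smul_mem _ r h
  | smul_right r x y hx hy h => rw [mul_smul_comm]; exact Submodule.smul_mem _ r h

/-- The closed span of a multiplicatively closed set is a Jordan algebra. -/
theorem isJordanSubalgebra_closure_span {P : Set (H →L[ℂ] H)}
    (hmul : ∀ p ∈ P, ∀ q ∈ P, p * q ∈ P) :
    IsJordanSubalgebra (Submodule.span ℝ P).topologicalClosure := by
  have hcl : ∀ a ∈ (Submodule.span ℝ P).topologicalClosure,
      ∀ b ∈ (Submodule.span ℝ P).topologicalClosure,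
      a * b ∈ (Submodule.span ℝ P).topologicalClosure := fun a ha b hb =>
    map_mem_closure₂ continuous_mul ha hb (mul_mem_span hmul)
  exact fun a ha b hb => Submodule.smul_mem _ _ (add_mem (hcl a ha b hb) (hcl b hb a ha))

/-- If `‖q - s b q‖ < 1` for a projection `q` commuting with `b`, then `q` is a limit of multiples
of `b`. -/
theorem mem_closure_mul_of_norm_lt {B : Submodule ℝ (H →L[ℂ] H)}
    (hcomm : ∀ a ∈ B, ∀ b ∈ B, Commute a b) (hmul : ∀ a ∈ B, ∀ b ∈ B, a * b ∈ B)
    {b q : H →L[ℂ] H} (hb : b ∈ B) (hq : q ∈ B) (hqq : q * q = q) {s : ℝ}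
    (hs : ‖q - s • (b * q)‖ < 1) : q ∈ closure ((fun y => b * y) '' (B : Set (H →L[ℂ] H))) := by
  set t := q - s • (b * q) with ht
  -- Since `q` acts as the unit on `t`, expanding a positive power of `t` leaves `q` plus multiples
  -- of `b`; the power `0` would give `1` instead of `q`. As `‖t‖ < 1`, these powers tend to `0`.
  have hpow : ∀ n : ℕ, ∃ y ∈ B, q - t ^ (n + 1) = b * y := by
    intro n
    induction n with
    | zero => exact ⟨s • q, B.smul_mem s hq, by rw [ht, zero_add, pow_one, mul_smul_comm]; abel⟩
    | succ n ih =>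
      obtain ⟨y, hy, hn⟩ := ih
      have htn : t ^ (n + 1) = q - b * y := by rw [← hn]; abel
      refine ⟨s • q + y * q - s • (y * (b * q)), B.sub_mem (B.add_mem (B.smul_mem s hq)
        (hmul y hy q hq)) (B.smul_mem s (hmul y hy _ (hmul b hb q hq))), ?_⟩
      rw [pow_succ, htn, ht]
      simp only [mul_sub, sub_mul, mul_add, mul_smul_comm, ← mul_assoc, hqq]
      rw [(hcomm q hq b hb).eq, mul_assoc b q q, hqq, smul_sub]
      abel
  have hlim : Filter.Tendsto (fun n : ℕ => q - t ^ (n + 1)) Filter.atTop (nhds q) := by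
    have h := (tendsto_pow_atTop_nhds_zero_of_norm_lt_one hs).comp (Filter.tendsto_add_atTop_nat 1)
    simpa using tendsto_const_nhds.sub h
  refine mem_closure_of_tendsto hlim (Filter.Eventually.of_forall fun n => ?_)
  obtain ⟨y, hy, hn⟩ := hpow n
  exact ⟨y, hy, hn.symm⟩

variable [CompleteSpace H]

/-! ### Commutative subalgebras and their projections. -/

/-- For positive `x`, `a⋆ x a = 0` forces `x a = 0`. -/
theorem mul_eq_zero_of_star_mul_mul {x a : H →L[ℂ] H} (hx : 0 ≤ x) (h : star a * x * a = 0) :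
    x * a = 0 := by
  obtain ⟨s, rfl⟩ := CStarAlgebra.nonneg_iff_eq_star_mul_self.1 hx
  have : s * a = 0 := by
    rw [← CStarRing.star_mul_self_eq_zero_iff, star_mul, ← h]
    simp only [mul_assoc]
  rw [mul_assoc, this, mul_zero]

/-- An associative Jordan algebra of self-adjoint operators is commutative. -/
theorem commute_of_assoc {B : Submodule ℝ (H →L[ℂ] H)} (hsa : ∀ a ∈ B, IsSelfAdjoint a)
    (hj : IsJordanSubalgebra B)
    (hassoc : ∀ a ∈ B, ∀ b ∈ B, ∀ c ∈ B, jmul (jmul a b) c = jmul a (jmul b c))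
    {a c : H →L[ℂ] H} (ha : a ∈ B) (hc : c ∈ B) : Commute a c := by
  -- Associativity of the triple `a, a, c` says `[a, [a, c]] = 0`.
  have key : ∀ a ∈ B, ∀ c ∈ B, a * (a * c - c * a) - (a * c - c * a) * a = 0 := by
    intro a ha c hc
    have h := hassoc a ha a ha c hc
    rw [jmul_self] at h
    have h4 := congrArg (fun x : H →L[ℂ] H => (4 : ℝ) • x) h
    simp only [jmul, mul_add, add_mul, mul_smul_comm, smul_mul_assoc, smul_add, smul_smul] at h4
    norm_num at h4
    have h5 : (2 : ℝ) • (a * a * c) + (2 : ℝ) • (c * (a * a))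
        = a * (a * c) + a * (c * a) + (a * c * a + c * a * a) := by
      rw [h4]
    simp only [two_smul, mul_assoc] at h5
    simp only [mul_sub, sub_mul, mul_assoc]
    rw [← sub_eq_zero] at h5
    rw [← h5]; abel
  have hcc : c * c ∈ B := jmul_self c ▸ hj c hc c hc
  set k := a * c - c * a with hk
  have h1 : a * k = k * a := sub_eq_zero.1 (key a ha c hc)
  have h1' : c * k = k * c := by
    have := key c hc a ha
    have e : c * a - a * c = -k := by rw [hk]; abel
    rw [e, mul_neg, neg_mul, sub_neg_eq_add, neg_add_eq_zero] at this
    exact this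
  -- With `k = [a, c]` commuting with `a` and `c`, one has `[a, c²] = 2kc` and `[a, 2kc] = 2k²`, so
  -- `k² = 0`; `k` is skew-adjoint, so `k = 0`.
  have h2 := key a ha (c * c) hcc
  have e2 : a * (c * c) - c * c * a = k * c + k * c := by
    conv_rhs => rw [← h1']
    rw [h1', hk]
    conv_rhs => arg 1; rw [← hk, ← h1', hk]
    noncomm_ring
  rw [e2] at h2
  have h3 : k * k + k * k = 0 := by
    rw [← h2]
    have : a * (k * c) - k * c * a = k * k := by
      rw [← mul_assoc, h1, mul_assoc, mul_assoc, ← mul_sub]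
    rw [← this]; noncomm_ring
  have h4 : k * k = 0 := by
    rw [← two_smul ℝ] at h3
    exact (smul_eq_zero.1 h3).resolve_left two_ne_zero
  have hks : star k = -k := by
    rw [hk, star_sub, star_mul, star_mul, (hsa a ha).star_eq, (hsa c hc).star_eq]; abel
  have : k = 0 := by
    rw [← CStarRing.star_mul_self_eq_zero_iff, hks, neg_mul, h4, neg_zero]
  exact sub_eq_zero.1 this

theorem isStarProjection_mul {p q : H →L[ℂ] H} (hp : IsStarProjection p)
    (hq : IsStarProjection q) (h : Commute p q) : IsStarProjection (p * q) :=
  ⟨hp.isIdempotentElem.mul_of_commute h hq.isIdempotentElem,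
    (IsSelfAdjoint.commute_iff hp.isSelfAdjoint hq.isSelfAdjoint).1 h⟩

theorem isStarProjection_sub_mul {p q : H →L[ℂ] H} (hp : IsStarProjection p)
    (hq : IsStarProjection q) (h : Commute p q) : IsStarProjection (p - p * q) := by
  have := isStarProjection_mul hp hq.one_sub ((Commute.one_right p).sub_right h)
  rwa [mul_sub, mul_one] at this

/-- Every commuting set in an AJW-algebra lies in a commutative subalgebra that is densely spanned
by its projections. -/
theorem IsAJWAlgebra.exists_commutative {A : Submodule ℝ (H →L[ℂ] H)} (hA : IsAJWAlgebra A)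
    {S : Set (H →L[ℂ] H)} (hSA : S ⊆ A) (hS : S.Pairwise Commute) :
    ∃ B : Submodule ℝ (H →L[ℂ] H), S ⊆ B ∧ B ≤ A ∧ (∀ a ∈ B, ∀ b ∈ B, Commute a b) ∧
      (∀ a ∈ B, ∀ b ∈ B, a * b ∈ B) ∧
      B ≤ (Submodule.span ℝ ((B : Set (H →L[ℂ] H)) ∩ projections A)).topologicalClosure := by
  obtain ⟨T, hST, hT⟩ := exists_maximal_pairwise Commute (A : Set (H →L[ℂ] H)) S hSA hS
  have hTc : ∀ a ∈ T, ∀ b ∈ T, Commute a b := fun a ha b hb => by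
    by_cases hab : a = b
    · rw [hab]
    · exact hT.prop.2 ha hb hab
  -- A maximal commuting set contains all of `A` that commutes with it. This makes it a subspace,
  -- closed under products, and a maximal associative subalgebra.
  have hmem : ∀ a ∈ A, (∀ b ∈ T, Commute a b) → a ∈ T := fun a ha hab => by
    refine hT.le_of_ge ⟨Set.insert_subset ha hT.prop.1, ?_⟩ (Set.subset_insert a T)
      (Set.mem_insert a T)
    exact hT.prop.2.insert fun b hb _ => ⟨hab b hb, (hab b hb).symm⟩
  let B : Submodule ℝ (H →L[ℂ] H) :=
    { carrier := T
      zero_mem' := hmem 0 A.zero_mem fun b _ => Commute.zero_left b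
      add_mem' := fun {a b} ha hb => hmem _ (A.add_mem (hT.prop.1 ha) (hT.prop.1 hb))
        fun c hc => (hTc a ha c hc).add_left (hTc b hb c hc)
      smul_mem' := fun r a ha => hmem _ (A.smul_mem r (hT.prop.1 ha))
        fun c hc => (hTc a ha c hc).smul_left r }
  have hBA : B ≤ A := hT.prop.1
  have hmul : ∀ a ∈ B, ∀ b ∈ B, a * b ∈ B := fun a ha b hb => by
    refine hmem _ ?_ fun c hc => (hTc a ha c hc).mul_left (hTc b hb c hc)
    rw [← jmul_eq_mul (hTc a ha b hb)]
    exact hA.jordan a (hBA ha) b (hBA hb)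
  have hBj : IsJordanSubalgebra B := fun a ha b hb => by
    rw [jmul_eq_mul (hTc a ha b hb)]
    exact hmul a ha b hb
  have hBmax : Maximal (IsAssocSubalgebra A) B := by
    refine ⟨⟨hBA, hBj, fun a ha b hb c hc => ?_⟩, fun C hC hBC c hc => ?_⟩
    · rw [jmul_eq_mul (hTc a ha b hb), jmul_eq_mul (hTc b hb c hc),
        jmul_eq_mul ((hTc a ha c hc).mul_left (hTc b hb c hc)),
        jmul_eq_mul ((hTc a ha b hb).mul_right (hTc a ha c hc)), mul_assoc]
    · exact hmem c (hC.1 hc) fun b hb => commute_of_assoc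
        (fun a ha => hA.isSelfAdjoint a (hC.1 ha)) hC.2.1 hC.2.2 hc (hBC hb)
  refine ⟨B, hST, hBA, hTc, hmul, ?_⟩
  conv_lhs => rw [hA.maximal_assoc B hBmax]
  refine sInf_le ⟨isJordanSubalgebra_closure_span ?_, Submodule.isClosed_topologicalClosure _,
    Submodule.subset_span.trans (Submodule.le_topologicalClosure _)⟩
  rintro p ⟨hp, hpA⟩ q ⟨hq, hqA⟩
  exact ⟨hmul p hp q hq, hBA (hmul p hp q hq), isStarProjection_mul hpA.2 hqA.2 (hTc p hp q hq)⟩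

/-- Compression by `1 - p` preserves `A`. -/
theorem IsJCAlgebra.compress_mem {A : Submodule ℝ (H →L[ℂ] H)} (hA : IsJCAlgebra A)
    {p a : H →L[ℂ] H} (hp : p ∈ A) (ha : a ∈ A) : (1 - p) * a * (1 - p) ∈ A := by
  -- The operator `1` need not lie in `A`, so the compression is rewritten with Jordan operations on
  -- `p` and `a` only.
  have h : (1 - p) * a * (1 - p) = a - (2 : ℝ) • jmul p a + jU p a := by
    rw [jU_eq, jmul, smul_smul]
    norm_num
    noncomm_ring
  have hj := hA.jordan p hp a ha
  rw [h]
  exact A.add_mem (A.sub_mem ha (A.smul_mem _ hj))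
    (A.sub_mem (A.smul_mem _ (hA.jordan p hp _ hj)) (hA.jordan _ (hA.jordan p hp p hp) a ha))

theorem IsJCAlgebra.mul_mul_mem {A : Submodule ℝ (H →L[ℂ] H)} (hA : IsJCAlgebra A)
    {a b : H →L[ℂ] H} (ha : a ∈ A) (hb : b ∈ A) : a * b * a ∈ A := by
  rw [← jU_eq]
  exact A.sub_mem (A.smul_mem _ (hA.jordan a ha _ (hA.jordan a ha b hb)))
    (hA.jordan _ (hA.jordan a ha a ha) b hb)

theorem IsJCAlgebra.mul_self_mem {A : Submodule ℝ (H →L[ℂ] H)} (hA : IsJCAlgebra A)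
    {a : H →L[ℂ] H} (ha : a ∈ A) : a * a ∈ A := jmul_self a ▸ hA.jordan a ha a ha

/-! ### Suprema of orthogonal families and the unit. -/

/-- Maximal orthogonal family of projections of `A` in `Q`, together with its supremum. -/
theorem IsAJWAlgebra.exists_sup {A : Submodule ℝ (H →L[ℂ] H)} (hA : IsAJWAlgebra A)
    (Q : Set (H →L[ℂ] H)) :
    ∃ T ⊆ Q ∩ projections A, ∃ e ∈ projections A, T.Pairwise Commute ∧ (∀ p ∈ T, p * e = p) ∧
      (∀ q ∈ projections A, (∀ p ∈ T, p * q = p) → e * q = e) ∧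
      (∀ q ∈ Q ∩ projections A, e * q = 0 → q = 0) := by
  obtain ⟨T, -, hT⟩ := exists_maximal_pairwise (fun p q : H →L[ℂ] H => p * q = 0)
    (Q ∩ projections A) ∅ (Set.empty_subset _) (Set.pairwise_empty _)
  obtain ⟨⟨e, he⟩, hlub⟩ := hA.exists_isLUB (Subtype.val ⁻¹' T) fun p hp q hq hpq =>
    hT.prop.2 hp hq fun h => hpq (Subtype.ext h)
  have hub : ∀ p ∈ T, p * e = p := fun p hp =>
    ((hT.prop.1 hp).2.2.le_iff_mul_eq_left he.2).1 (hlub.1 (show ⟨p, (hT.prop.1 hp).2⟩ ∈ _ from hp))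
  refine ⟨T, hT.prop.1, e, he, fun p hp q hq hpq => ?_, hub, fun q hq hpq => ?_, fun q hq heq => ?_⟩
  · exact (hT.prop.2 hp hq hpq).trans (hT.prop.2 hq hp hpq.symm).symm
  · refine (he.2.le_iff_mul_eq_left hq.2).1 (hlub.2 (show ⟨q, hq⟩ ∈ _ from ?_))
    rintro ⟨p, hpA⟩ hp
    exact (hpA.2.le_iff_mul_eq_left hq.2).2 (hpq p hp)
  · have hpq : ∀ p ∈ T, p * q = 0 := fun p hp => by rw [← hub p hp, mul_assoc, heq, mul_zero]
    have hqT : q ∈ T := by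
      refine hT.le_of_ge ⟨Set.insert_subset hq hT.prop.1, ?_⟩ (Set.subset_insert q T)
        (Set.mem_insert q T)
      refine hT.prop.2.insert fun p hp _ => ⟨?_, hpq p hp⟩
      have := congrArg star (hpq p hp)
      rwa [star_mul, hq.2.2.isSelfAdjoint.star_eq, (hT.prop.1 hp).2.2.isSelfAdjoint.star_eq,
        star_zero] at this
    rw [← hq.2.2.isIdempotentElem.eq]
    exact hpq q hqT

/-- An AJW-algebra has a unit. -/
theorem IsAJWAlgebra.exists_unit {A : Submodule ℝ (H →L[ℂ] H)} (hA : IsAJWAlgebra A) :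
    ∃ u ∈ projections A, ∀ a ∈ A, u * a = a ∧ a * u = a := by
  obtain ⟨-, -, u, hu, -, -, -, hmax⟩ := hA.exists_sup Set.univ
  have hup : u * (1 - u) = 0 := hu.2.mul_one_sub_self
  have hpu : (1 - u) * u = 0 := hu.2.one_sub_mul_self
  have hcomp : ∀ a ∈ A, (1 - u) * a * (1 - u) = 0 := by
    intro a ha
    set b := (1 - u) * a * (1 - u) with hb
    have hub : u * b = 0 := by rw [hb, mul_assoc, ← mul_assoc, hup, zero_mul]
    have hbu : b * u = 0 := by rw [hb, mul_assoc, hpu, mul_zero]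
    obtain ⟨B, hSB, hBA, hcomm, hmul, hdense⟩ := hA.exists_commutative (S := {u, b})
      (by rintro x (rfl | rfl); exacts [hu.1, hA.compress_mem hu.1 ha])
      (Set.pairwise_pair.2 fun _ => ⟨hub.trans hbu.symm, hbu.trans hub.symm⟩)
    have huB : u ∈ B := hSB (by simp)
    have hspan : ((Submodule.span ℝ ((B : Set (H →L[ℂ] H)) ∩ projections A)).topologicalClosure :
        Set (H →L[ℂ] H)) ⊆ {x | u * x = x} := by
      -- For a projection `q` of `B`, `q - qu` is a projection orthogonal to `u`, hence zero by
      -- maximality. So `u` is a unit on `B`, while `ub = 0`.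
      refine closure_minimal ?_ (isClosed_eq (by fun_prop) continuous_id)
      intro x hx
      induction hx using Submodule.span_induction with
      | mem q hq =>
        have hc := hcomm q hq.1 u huB
        have hz := hmax (q - q * u) ⟨trivial, A.sub_mem hq.2.1 (hBA (hmul q hq.1 u huB)),
          isStarProjection_sub_mul hq.2.2 hu.2 hc⟩
          (by rw [hc.eq, mul_sub, ← mul_assoc, hu.2.isIdempotentElem.eq, sub_self])
        exact (hc.eq.symm.trans (sub_eq_zero.1 hz).symm)
      | zero => exact mul_zero u
      | add x y _ _ h1 h2 =>
        rw [Set.mem_ofPred_eq] at *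
        rw [mul_add, h1, h2]
      | smul r x _ h =>
        rw [Set.mem_ofPred_eq] at *
        rw [mul_smul_comm, h]
    have h := hspan (hdense (hSB (by simp) : b ∈ B))
    rw [Set.mem_ofPred_eq] at h
    rw [← h, hub]
  refine ⟨u, hu, fun a ha => ?_⟩
  have hsa := (hA.isSelfAdjoint a ha).star_eq
  have hpsa := hu.2.one_sub.isSelfAdjoint.star_eq
  have h : a * (1 - u) = 0 := by
    rw [← CStarRing.star_mul_self_eq_zero_iff, star_mul, hsa, hpsa, ← mul_assoc,
      mul_assoc (1 - u) a a]
    exact hcomp _ (hA.mul_self_mem ha)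
  have h' : (1 - u) * a = 0 := by
    have := congrArg star h
    rwa [star_mul, hsa, hpsa, star_zero] at this
  rw [mul_sub, mul_one, sub_eq_zero] at h
  rw [sub_mul, one_mul, sub_eq_zero] at h'
  exact ⟨h'.symm, h.symm⟩

/-! ### A projection below a nonzero element. -/

/-- A real linear combination `d` of projections from a Boolean ring `P` of projections has, below
every nonzero `r ∈ P`, a nonzero eigenprojection whose eigenvalue bounds the norm of `d` on `r`. -/
theorem exists_eigenprojection {P : Set (H →L[ℂ] H)} (hproj : ∀ p ∈ P, IsStarProjection p)
    (hcomm : ∀ p ∈ P, ∀ q ∈ P, Commute p q) (hmul : ∀ p ∈ P, ∀ q ∈ P, p * q ∈ P)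
    (hsub : ∀ p ∈ P, ∀ q ∈ P, p - p * q ∈ P) :
    ∀ (n : ℕ) (c : Fin n → ℝ) (g : Fin n → P), ∀ r ∈ P, r ≠ 0 → ∀ μ : ℝ,
      ∃ q ∈ P, q ≠ 0 ∧ r * q = q ∧ ∃ t : ℝ,
        (∑ i, c i • (g i : H →L[ℂ] H)) * q = t • q ∧
        ‖(∑ i, c i • (g i : H →L[ℂ] H) + μ • 1) * r‖ ≤ |t + μ| := by
  intro n
  -- The shift `μ` serves the induction: below `r * p` the term `γ • p` acts as the scalar `γ` and
  -- is absorbed into `μ`; below `r - r * p` it vanishes.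
  induction n with
  | zero =>
    intro c g r hr hr0 μ
    refine ⟨r, hr, hr0, (hproj r hr).isIdempotentElem.eq, 0, by simp, ?_⟩
    simp only [Finset.univ_eq_empty, Finset.sum_empty, zero_add, smul_mul_assoc, one_mul,
      norm_smul, Real.norm_eq_abs]
    exact mul_le_of_le_one_right (abs_nonneg μ) (hproj r hr).norm_le
  | succ n ih =>
    intro c g r hr hr0 μ
    have hsum : ∑ i, c i • (g i : H →L[ℂ] H)
        = c 0 • (g 0 : H →L[ℂ] H) + ∑ i : Fin n, c i.succ • (g i.succ : H →L[ℂ] H) :=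
      Fin.sum_univ_succ _
    rw [hsum]
    set d := ∑ i : Fin n, c i.succ • (g i.succ : H →L[ℂ] H) with hd
    obtain ⟨p, hp⟩ := g 0
    set γ := c 0
    dsimp only
    have hdsa : IsSelfAdjoint d :=
      isSelfAdjoint_sum _ fun i _ =>
        IsSelfAdjoint.smul (IsSelfAdjoint.all (c i.succ)) (hproj _ (g i.succ).2).isSelfAdjoint
    have hdc : ∀ s ∈ P, Commute d s := fun s hs =>
      Commute.sum_left _ _ _ fun i _ => (hcomm _ (g i.succ).2 s hs).smul_left _
    have below : ∀ ν : ℝ, ∀ s ∈ P, Commute (d + ν • 1) s := fun ν s hs =>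
      (hdc s hs).add_left ((Commute.one_left s).smul_left ν)
    have hrp := hmul r hr p hp
    have hrs := hsub r hr p hp
    have hpr := hcomm p hp r hr
    have hpp := (hproj p hp).isIdempotentElem.eq
    have hrr := (hproj r hr).isIdempotentElem.eq
    -- a good `q` below `r * p` or below `r - r * p` is good below `r`
    have inside : r * p ≠ 0 → ∃ q ∈ P, q ≠ 0 ∧ r * q = q ∧ ∃ t : ℝ,
        (γ • p + d) * q = t • q ∧ ‖(d + (γ + μ) • 1) * (r * p)‖ ≤ |t + μ| := by
      intro h0
      obtain ⟨q, hq, hq0, hrq, t, ht, hnorm⟩ :=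
        ih (fun i => c i.succ) (fun i => g i.succ) (r * p) hrp h0 (γ + μ)
      have hrq' : r * q = q := by rw [← hrq, ← mul_assoc, ← mul_assoc, hrr]
      have hpq : p * q = q := by
        rw [← hrq, ← mul_assoc, ← mul_assoc, hpr.eq, mul_assoc r p p, hpp]
      refine ⟨q, hq, hq0, hrq', γ + t, ?_, ?_⟩
      · rw [add_mul, smul_mul_assoc, hpq, ht, add_smul]
      · rw [show γ + t + μ = t + (γ + μ) by ring]
        exact hnorm
    have outside : r - r * p ≠ 0 → ∃ q ∈ P, q ≠ 0 ∧ r * q = q ∧ ∃ t : ℝ,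
        (γ • p + d) * q = t • q ∧ ‖(d + μ • 1) * (r - r * p)‖ ≤ |t + μ| := by
      intro h0
      obtain ⟨q, hq, hq0, hrq, t, ht, hnorm⟩ :=
        ih (fun i => c i.succ) (fun i => g i.succ) (r - r * p) hrs h0 μ
      have hrq' : r * q = q := by
        rw [← hrq, ← mul_assoc, mul_sub, ← mul_assoc, hrr]
      have hpq : p * q = 0 := by
        rw [← hrq, ← mul_assoc, mul_sub, ← mul_assoc, hpr.eq, mul_assoc r p p, hpp, sub_self,
          zero_mul]
      refine ⟨q, hq, hq0, hrq', t, ?_, hnorm⟩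
      rw [add_mul, smul_mul_assoc, hpq, ht, smul_zero, zero_add]
    have hsplit : (γ • p + d + μ • 1) * r
        = (d + (γ + μ) • 1) * (r * p) + (d + μ • 1) * (r - r * p) := by
      simp only [add_mul, mul_sub, smul_mul_assoc, one_mul, hpr.eq, add_smul]
      abel
    -- The two summands are self-adjoint and orthogonal, so the norm of the sum is the larger norm;
    -- `q` is sought on that side.
    have hle : ‖(γ • p + d + μ • 1) * r‖
        ≤ max ‖(d + (γ + μ) • 1) * (r * p)‖ ‖(d + μ • 1) * (r - r * p)‖ := by
      have hsa : ∀ ν : ℝ, ∀ s ∈ P, IsSelfAdjoint ((d + ν • 1) * s) := fun ν s hs =>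
        (IsSelfAdjoint.commute_iff
          (hdsa.add (IsSelfAdjoint.smul (IsSelfAdjoint.all ν) (IsSelfAdjoint.one _)))
          (hproj s hs).isSelfAdjoint).1 (below ν s hs)
      rw [hsplit]
      refine ((hsa _ _ hrp).norm_add_eq_max (hsa _ _ hrs) ?_).le
      have hz : r * p * (r - r * p) = 0 := by
        rw [mul_sub, mul_assoc r p r, hpr.eq, ← mul_assoc, hrr, mul_assoc r p (r * p),
          ← mul_assoc p r p, hpr.eq, mul_assoc r p p, hpp, ← mul_assoc, hrr, sub_self]
      rw [(below μ _ hrs).eq, mul_assoc, ← mul_assoc (r * p), hz, zero_mul, mul_zero]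
    by_cases h1 : r * p = 0
    · rw [h1, mul_zero, norm_zero, max_eq_right (norm_nonneg _)] at hle
      obtain ⟨q, hq, hq0, hrq, t, ht, hnorm⟩ := outside (by rw [h1, sub_zero]; exact hr0)
      rw [h1] at hnorm
      exact ⟨q, hq, hq0, hrq, t, ht, hle.trans hnorm⟩
    by_cases h2 : r - r * p = 0
    · rw [h2, mul_zero, norm_zero, max_eq_left (norm_nonneg _)] at hle
      obtain ⟨q, hq, hq0, hrq, t, ht, hnorm⟩ := inside h1
      exact ⟨q, hq, hq0, hrq, t, ht, hle.trans hnorm⟩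
    rcases le_total ‖(d + (γ + μ) • 1) * (r * p)‖ ‖(d + μ • 1) * (r - r * p)‖ with h | h
    · rw [max_eq_right h] at hle
      obtain ⟨q, hq, hq0, hrq, t, ht, hnorm⟩ := outside h2
      exact ⟨q, hq, hq0, hrq, t, ht, hle.trans hnorm⟩
    · rw [max_eq_left h] at hle
      obtain ⟨q, hq, hq0, hrq, t, ht, hnorm⟩ := inside h1
      exact ⟨q, hq, hq0, hrq, t, ht, hle.trans hnorm⟩

/-- Below every nonzero element `b` of a commuting family in an AJW-algebra there is a nonzero
projection, commuting with the family, which is a limit of multiples of `b`. -/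
theorem IsAJWAlgebra.exists_projection {A : Submodule ℝ (H →L[ℂ] H)} (hA : IsAJWAlgebra A)
    {S : Set (H →L[ℂ] H)} (hSA : S ⊆ A) (hS : S.Pairwise Commute) {b : H →L[ℂ] H} (hb : b ∈ S)
    (hb0 : b ≠ 0) :
    ∃ q ∈ projections A, q ≠ 0 ∧ (∀ s ∈ S, Commute s q) ∧
      q ∈ closure ((fun y => b * y) '' (A : Set (H →L[ℂ] H))) := by
  obtain ⟨u, hu, hunit⟩ := hA.exists_unit
  obtain ⟨B, hSB, hBA, hcomm, hmul, hdense⟩ := hA.exists_commutative (S := insert u S)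
    (Set.insert_subset hu.1 hSA) (hS.insert fun a ha _ => by
      obtain ⟨h1, h2⟩ := hunit a (hSA ha)
      exact ⟨h1.trans h2.symm, h2.trans h1.symm⟩)
  have huB : u ∈ B := hSB (Set.mem_insert u S)
  have hbB : b ∈ B := hSB (Set.mem_insert_of_mem u hb)
  have hnb : 0 < ‖b‖ := norm_pos_iff.2 hb0
  -- Within `‖b‖ / 2` one gets `‖b - d‖ < ‖d‖ ≤ |t|`, where `dq = tq`. Then `t⁻¹ • (b * q)` is at
  -- distance less than `1` from `q`.
  obtain ⟨d, hd, hbd⟩ := Metric.mem_closure_iff.1 (hdense hbB) (‖b‖ / 2) (half_pos hnb)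
  obtain ⟨n, c, g, rfl⟩ := Submodule.mem_span_set'.1 hd
  have hu0 : u ≠ 0 := fun h => hb0 (by rw [← (hunit b (hSA hb)).1, h, zero_mul])
  obtain ⟨q, hq, hq0, -, t, ht, hnorm⟩ := exists_eigenprojection
    (P := (B : Set (H →L[ℂ] H)) ∩ projections A) (fun p hp => hp.2.2)
    (fun p hp q hq => hcomm p hp.1 q hq.1)
    (fun p hp q hq => ⟨hmul p hp.1 q hq.1, hBA (hmul p hp.1 q hq.1),
      isStarProjection_mul hp.2.2 hq.2.2 (hcomm p hp.1 q hq.1)⟩)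
    (fun p hp q hq => ⟨B.sub_mem hp.1 (hmul p hp.1 q hq.1),
      A.sub_mem hp.2.1 (hBA (hmul p hp.1 q hq.1)),
      isStarProjection_sub_mul hp.2.2 hq.2.2 (hcomm p hp.1 q hq.1)⟩)
    n c g u ⟨huB, hu⟩ hu0 0
  set d := ∑ i, c i • (g i : H →L[ℂ] H) with hdef
  have hdA : d ∈ A := A.sum_mem fun i _ => A.smul_mem _ (g i).2.2.1
  rw [zero_smul, add_zero, add_zero, (hunit d hdA).2] at hnorm
  rw [dist_eq_norm] at hbd
  have hdt : ‖b - d‖ < |t| := by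
    have := norm_sub_norm_le b d
    linarith
  have ht0 : t ≠ 0 := abs_pos.1 ((norm_nonneg _).trans_lt hdt)
  have hcl : ‖q - t⁻¹ • (b * q)‖ < 1 := by
    have h : q - t⁻¹ • (b * q) = -(t⁻¹ • ((b - d) * q)) := by
      rw [sub_mul, ht, smul_sub, smul_smul, inv_mul_cancel₀ ht0, one_smul]
      abel
    rw [h, norm_neg, norm_smul, norm_inv, Real.norm_eq_abs, inv_mul_lt_iff₀ (abs_pos.2 ht0),
      mul_one]
    refine ((norm_mul_le _ _).trans ?_).trans_lt hdt
    exact mul_le_of_le_one_right (norm_nonneg _) hq.2.2.norm_le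
  refine ⟨q, hq.2, hq0, fun s hs => hcomm s (hSB (Set.mem_insert_of_mem u hs)) q hq.1, ?_⟩
  exact closure_mono (Set.image_mono hBA)
    (mem_closure_mul_of_norm_lt hcomm hmul hbB hq.1 hq.2.2.isIdempotentElem.eq hcl)

/-! ### Reversibility and the real star-algebra. -/

theorem star_list_prod {l : List (H →L[ℂ] H)} (hl : ∀ a ∈ l, IsSelfAdjoint a) :
    star l.prod = l.reverse.prod := by
  induction l with
  | nil => simp
  | cons a l ih =>
    rw [List.prod_cons, star_mul, ih fun b hb => hl b (List.mem_cons_of_mem a hb),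
      (hl a List.mem_cons_self).star_eq]
    simp

/-- For reversible `A`, the self-adjoint part of `R*(A)` is `A`. -/
theorem IsReversible.mem_of_mem_realStarAlg {A : Submodule ℝ (H →L[ℂ] H)} (hA : IsJCAlgebra A)
    (hrev : IsReversible A) {x : H →L[ℂ] H} (hx : x ∈ realStarAlg (A : Set (H →L[ℂ] H)))
    (hsa : IsSelfAdjoint x) : x ∈ A := by
  -- Words in `A`: the adjoint of a word is its reversal, so reversibility gives `y + star y ∈ A` on
  -- their span and, by continuity, on `R*(A)`.
  let W : Set (H →L[ℂ] H) := {w | ∃ l : List (H →L[ℂ] H), l ≠ [] ∧ (∀ a ∈ l, a ∈ A) ∧ l.prod = w}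
  have hW : ∀ w ∈ W, ∀ w' ∈ W, w * w' ∈ W := by
    rintro _ ⟨l, hl, hlA, rfl⟩ _ ⟨m, hm, hmA, rfl⟩
    refine ⟨l ++ m, by simp [hl], fun a ha => ?_, List.prod_append⟩
    exact (List.mem_append.1 ha).elim (hlA a) (hmA a)
  have hWs : ∀ w ∈ W, star w ∈ W := by
    rintro _ ⟨l, hl, hlA, rfl⟩
    exact ⟨l.reverse, by simpa using hl, fun a ha => hlA a (List.mem_reverse.1 ha),
      (star_list_prod fun a ha => hA.isSelfAdjoint a (hlA a ha)).symm⟩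
  have hadj : ∀ y ∈ NonUnitalStarAlgebra.adjoin ℝ (A : Set (H →L[ℂ] H)),
      y ∈ Submodule.span ℝ W := by
    intro y hy
    induction hy using NonUnitalStarAlgebra.adjoin_induction with
    | mem a ha => exact Submodule.subset_span ⟨[a], by simp, by simpa using ha, by simp⟩
    | add y z _ _ h1 h2 => exact add_mem h1 h2
    | zero => exact zero_mem _
    | mul y z _ _ h1 h2 => exact mul_mem_span hW y h1 z h2
    | smul r y _ h => exact Submodule.smul_mem _ r h
    | star y hy h =>
      clear hy
      induction h using Submodule.span_induction with
      | mem w hw => exact Submodule.subset_span (hWs w hw)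
      | zero => simp
      | add y z _ _ h1 h2 => rw [star_add]; exact add_mem h1 h2
      | smul r y _ h => rw [star_smul]; exact Submodule.smul_mem _ _ h
  have hadd : ∀ y ∈ Submodule.span ℝ W, y + star y ∈ A := by
    intro y hy
    induction hy using Submodule.span_induction with
    | mem w hw =>
      obtain ⟨l, hl, hlA, rfl⟩ := hw
      rw [star_list_prod fun a ha => hA.isSelfAdjoint a (hlA a ha)]
      exact hrev l hl hlA
    | zero => simp
    | add y z _ _ h1 h2 =>
      rw [star_add, add_add_add_comm]
      exact A.add_mem h1 h2
    | smul r y _ h =>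
      rw [star_smul, star_trivial, ← smul_add]
      exact A.smul_mem r h
  have hcl : x + star x ∈ A :=
    closure_minimal (fun y hy => hadd y (hadj y hy))
      (hA.isClosed.preimage (f := fun y : H →L[ℂ] H => y + star y)
        (continuous_id.add continuous_star)) hx
  have : x = (1 / 2 : ℝ) • (x + star x) := by
    rw [hsa.star_eq, ← two_smul ℝ x, smul_smul]
    norm_num
  rw [this]
  exact A.smul_mem _ hcl

theorem subset_realStarAlg (S : Set (H →L[ℂ] H)) : S ⊆ realStarAlg S :=
  (NonUnitalStarAlgebra.subset_adjoin ℝ S).trans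
    (NonUnitalStarSubalgebra.le_topologicalClosure _)

/-! ### The ideal `R* ∩ iR*`. -/

theorem mem_realInterI {S : Set (H →L[ℂ] H)} {x : H →L[ℂ] H} :
    x ∈ realInterI S ↔ x ∈ realStarAlg S ∧ Complex.I • x ∈ realStarAlg S := by
  refine and_congr_right fun _ => ⟨?_, fun h => ⟨-(Complex.I • x), neg_mem h, ?_⟩⟩
  · rintro ⟨y, hy, rfl⟩
    simpa [smul_smul] using neg_mem (show y ∈ realStarAlg S from hy)
  · simp [smul_smul]

/-- `R*(S) ∩ iR*(S)` as a complex subspace. -/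
def realInterISubmodule (S : Set (H →L[ℂ] H)) : Submodule ℂ (H →L[ℂ] H) where
  carrier := realInterI S
  zero_mem' := mem_realInterI.2 ⟨zero_mem _, by rw [smul_zero]; exact zero_mem _⟩
  add_mem' := fun {x y} hx hy => by
    rw [mem_realInterI] at *
    exact ⟨add_mem hx.1 hy.1, by rw [smul_add]; exact add_mem hx.2 hy.2⟩
  smul_mem' := fun c x hx => by
    rw [mem_realInterI] at *
    have hc : c • x = c.re • x + c.im • (Complex.I • x) := by
      rw [← Complex.coe_smul c.re x, ← Complex.coe_smul c.im, smul_smul, ← add_smul,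
        Complex.re_add_im]
    have hci : Complex.I • c • x = c.re • (Complex.I • x) - c.im • x := by
      rw [hc, smul_add, smul_comm Complex.I c.re, smul_comm Complex.I c.im, smul_smul Complex.I,
        Complex.I_mul_I, neg_one_smul, smul_neg, sub_eq_add_neg]
    rw [hci, hc]
    exact ⟨add_mem (SMulMemClass.smul_mem _ hx.1) (SMulMemClass.smul_mem _ hx.2),
      sub_mem (SMulMemClass.smul_mem _ hx.2) (SMulMemClass.smul_mem _ hx.1)⟩

theorem mem_realInterISubmodule {S : Set (H →L[ℂ] H)} {x : H →L[ℂ] H} :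
    x ∈ realInterISubmodule S ↔ x ∈ realStarAlg S ∧ Complex.I • x ∈ realStarAlg S :=
  mem_realInterI

theorem star_mem_realInterISubmodule {S : Set (H →L[ℂ] H)} {x : H →L[ℂ] H}
    (hx : x ∈ realInterISubmodule S) : star x ∈ realInterISubmodule S := by
  rw [mem_realInterISubmodule] at *
  refine ⟨star_mem hx.1, ?_⟩
  have : Complex.I • star x = -star (Complex.I • x) := by simp [star_smul]
  rw [this]
  exact neg_mem (star_mem hx.2)

theorem realStarAlg_subset_cStarAlg (S : Set (H →L[ℂ] H)) :
    (realStarAlg S : Set (H →L[ℂ] H)) ⊆ cStarAlg S := by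
  refine closure_mono fun x hx => ?_
  change x ∈ NonUnitalStarAlgebra.adjoin ℂ S
  change x ∈ NonUnitalStarAlgebra.adjoin ℝ S at hx
  induction hx using NonUnitalStarAlgebra.adjoin_induction with
  | mem a ha => exact NonUnitalStarAlgebra.subset_adjoin ℂ S ha
  | add y z _ _ h1 h2 => exact add_mem h1 h2
  | zero => exact zero_mem _
  | mul y z _ _ h1 h2 => exact mul_mem h1 h2
  | smul r y _ h => rw [← Complex.coe_smul]; exact SMulMemClass.smul_mem _ h
  | star y _ h => exact star_mem h

/-- Generators lie in `R*(S)`, and the factor `i` moves through products, so they multiply `I` into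
itself. Since `I` is a closed complex subspace stable under the adjoint, this extends to `C*(S)`. -/
theorem isClosedTwoSidedIdeal_realInterISubmodule (S : Set (H →L[ℂ] H)) :
    IsClosedTwoSidedIdeal (cStarAlg S) (realInterISubmodule S) := by
  set I := realInterISubmodule S
  have hR : IsClosed (realStarAlg S : Set (H →L[ℂ] H)) := isClosed_closure
  have hclosed : IsClosed (I : Set (H →L[ℂ] H)) := by
    have : (I : Set (H →L[ℂ] H)) = (realStarAlg S : Set (H →L[ℂ] H)) ∩
        (fun x : H →L[ℂ] H => Complex.I • x) ⁻¹' (realStarAlg S : Set (H →L[ℂ] H)) :=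
      Set.ext fun x => mem_realInterISubmodule
    rw [this]
    exact hR.inter (hR.preimage (continuous_const_smul Complex.I))
  have hadj : ∀ c ∈ NonUnitalStarAlgebra.adjoin ℂ S, ∀ x ∈ I, c * x ∈ I ∧ x * c ∈ I := by
    intro c hc
    induction hc using NonUnitalStarAlgebra.adjoin_induction with
    | mem a ha =>
      intro x hx
      have haR : a ∈ realStarAlg S := subset_realStarAlg S ha
      rw [mem_realInterISubmodule] at hx
      rw [mem_realInterISubmodule, mem_realInterISubmodule, ← mul_smul_comm, ← smul_mul_assoc]
      exact ⟨⟨mul_mem haR hx.1, mul_mem haR hx.2⟩, mul_mem hx.1 haR, mul_mem hx.2 haR⟩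
    | add y z _ _ h1 h2 =>
      intro x hx
      rw [add_mul, mul_add]
      exact ⟨add_mem (h1 x hx).1 (h2 x hx).1, add_mem (h1 x hx).2 (h2 x hx).2⟩
    | zero => intro x _; simp
    | mul y z _ _ h1 h2 =>
      intro x hx
      rw [mul_assoc, ← mul_assoc x]
      exact ⟨(h1 _ (h2 x hx).1).1, (h2 _ (h1 x hx).2).2⟩
    | smul r y _ h =>
      intro x hx
      rw [smul_mul_assoc, mul_smul_comm]
      exact ⟨I.smul_mem r (h x hx).1, I.smul_mem r (h x hx).2⟩
    | star y _ h =>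
      intro x hx
      have h' := h (star x) (star_mem_realInterISubmodule hx)
      refine ⟨?_, ?_⟩
      · simpa using star_mem_realInterISubmodule h'.2
      · simpa using star_mem_realInterISubmodule h'.1
  have hmul : ∀ c ∈ cStarAlg S, ∀ x ∈ I, c * x ∈ I ∧ x * c ∈ I := fun c hc x hx =>
    closure_minimal (fun c hc => hadj c hc x hx)
      ((hclosed.preimage (continuous_mul_const x)).inter
        (hclosed.preimage (continuous_const_mul x))) hc
  exact ⟨fun x hx => realStarAlg_subset_cStarAlg S (mem_realInterISubmodule.1 hx).1,
    fun c hc x hx => (hmul c hc x hx).1, fun c hc x hx => (hmul c hc x hx).2, hclosed⟩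

/-! ### The central cover of an ideal. -/

theorem mul_eq_right_of_mul_eq_left {p e : H →L[ℂ] H} (hp : IsStarProjection p)
    (he : IsStarProjection e) (h : p * e = p) : e * p = p := by
  have := congrArg star h
  rwa [star_mul, hp.isSelfAdjoint.star_eq, he.isSelfAdjoint.star_eq] at this

/-- A positive element annihilating a commuting family of projections annihilates its supremum. -/
theorem IsAJWAlgebra.mul_sup_eq_zero {A : Submodule ℝ (H →L[ℂ] H)} (hA : IsAJWAlgebra A)
    {T : Set (H →L[ℂ] H)} (hT : T ⊆ projections A) (hcomm : T.Pairwise Commute)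
    {e : H →L[ℂ] H} (he : e ∈ projections A) (hub : ∀ p ∈ T, p * e = p)
    (hlub : ∀ q ∈ projections A, (∀ p ∈ T, p * q = p) → e * q = e)
    {x : H →L[ℂ] H} (hxA : x ∈ A) (hx : 0 ≤ x) (hxT : ∀ p ∈ T, x * p = 0) : x * e = 0 := by
  have hee := he.2.isIdempotentElem.eq
  have hub' : ∀ p ∈ T, e * p = p := fun p hp =>
    mul_eq_right_of_mul_eq_left (hT hp).2 he.2 (hub p hp)
  have hxT' : ∀ p ∈ T, p * x = 0 := fun p hp => by
    have := congrArg star (hxT p hp)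
    rwa [star_mul, (hT hp).2.isSelfAdjoint.star_eq, (hA.isSelfAdjoint x hxA).star_eq,
      star_zero] at this
  refine mul_eq_zero_of_star_mul_mul hx ?_
  rw [he.2.isSelfAdjoint.star_eq]
  -- If `exe ≠ 0`, a nonzero projection `q` in the closure of `exeA` lies below `e` and is
  -- orthogonal to `T`. Then `e - q` is a smaller upper bound of `T`.
  by_contra hb0
  have hbA : e * x * e ∈ A := hA.mul_mul_mem he.1 hxA
  have heb : e * (e * x * e) = e * x * e := by simp only [← mul_assoc, hee]
  have hbe : e * x * e * e = e * x * e := by rw [mul_assoc, hee]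
  have hbp : ∀ p ∈ T, e * x * e * p = 0 := fun p hp => by
    rw [mul_assoc, hub' p hp, mul_assoc, hxT p hp, mul_zero]
  have hpb : ∀ p ∈ T, p * (e * x * e) = 0 := fun p hp => by
    rw [← mul_assoc, ← mul_assoc, hub p hp, hxT' p hp, zero_mul]
  have hS : (insert e (insert (e * x * e) T)).Pairwise Commute := by
    refine (hcomm.insert fun p hp _ => ?_).insert ?_
    · exact ⟨(hbp p hp).trans (hpb p hp).symm, (hpb p hp).trans (hbp p hp).symm⟩
    · rintro p (rfl | hp) _
      · exact ⟨heb.trans hbe.symm, hbe.trans heb.symm⟩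
      · exact ⟨(hub' p hp).trans (hub p hp).symm, (hub p hp).trans (hub' p hp).symm⟩
  obtain ⟨q, hq, hq0, hqc, hqcl⟩ := hA.exists_projection (b := e * x * e)
    (Set.insert_subset he.1 (Set.insert_subset hbA fun p hp => (hT hp).1)) hS
    (Set.mem_insert_of_mem _ (Set.mem_insert _ _)) hb0
  have hpq : ∀ p ∈ T, p * q = 0 := fun p hp => by
    refine closure_minimal (t := {z | p * z = 0}) ?_
      (isClosed_eq (continuous_const_mul p) continuous_const) hqcl
    rintro _ ⟨y, -, rfl⟩
    change p * (e * x * e * y) = 0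
    rw [← mul_assoc, hpb p hp, zero_mul]
  have heq : e * q = q := by
    refine closure_minimal (t := {z | e * z = z}) ?_
      (isClosed_eq (continuous_const_mul e) continuous_id) hqcl
    rintro _ ⟨y, -, rfl⟩
    change e * (e * x * e * y) = e * x * e * y
    rw [← mul_assoc, heb]
  have hsub := isStarProjection_sub_mul he.2 hq.2 (hqc e (Set.mem_insert _ _))
  rw [heq] at hsub
  have h := hlub (e - q) ⟨A.sub_mem he.1 hq.1, hsub⟩ fun p hp => by
    rw [mul_sub, hub p hp, hpq p hp, sub_zero]
  rw [mul_sub, hee, heq] at h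
  exact hq0 (sub_eq_self.1 h)

/-- The supremum `e` of the projections of an ideal `I` of `C*(A)`: it is a central projection, a
unit for `I`, and the annihilator of `I` in `A₊` is the annihilator of `e`. -/
theorem IsAJWAlgebra.exists_central_cover {A : Submodule ℝ (H →L[ℂ] H)} (hA : IsAJWAlgebra A)
    {I : Submodule ℂ (H →L[ℂ] H)} (hI : IsClosedTwoSidedIdeal (cStarAlg (A : Set (H →L[ℂ] H))) I)
    (hstar : ∀ z ∈ I, star z ∈ I) (hsa : saPart (I : Set (H →L[ℂ] H)) ⊆ A) :
    ∃ e, IsCentralProjection A e ∧ (∀ z ∈ I, e * z = z ∧ z * e = z) ∧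
      ∀ x ∈ posCone A, (∀ p ∈ saPart (I : Set (H →L[ℂ] H)), x * p = 0) → x * e = 0 := by
  have hAC : ∀ a ∈ A, a ∈ cStarAlg (A : Set (H →L[ℂ] H)) := fun a ha =>
    realStarAlg_subset_cStarAlg _ (subset_realStarAlg _ ha)
  obtain ⟨T, hTQ, e, he, hcomm, hub, hlub, hmax⟩ := hA.exists_sup (I : Set (H →L[ℂ] H))
  have hTA : T ⊆ projections A := fun p hp => (hTQ hp).2
  have hesa := he.2.isSelfAdjoint.star_eq
  have hvsa := he.2.one_sub.isSelfAdjoint.star_eq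
  have hz : ∀ z ∈ I, z * (1 - e) = 0 := by
    intro z hz
    have hzz : star z * z ∈ I := hI.mul_left _ (hI.subset _ (hstar z hz)) z hz
    have hzA : star z * z ∈ A := hsa ⟨hzz, IsSelfAdjoint.star_mul_self z⟩
    rw [← CStarRing.star_mul_self_eq_zero_iff, star_mul, hvsa, mul_assoc, ← mul_assoc (star z),
      ← mul_assoc]
    -- A projection in the closure of `bA` lies in `I` and is orthogonal to `e`, against the
    -- maximality of `T`.
    by_contra hb0
    set b := (1 - e) * (star z * z) * (1 - e) with hb
    have hbA : b ∈ A := hA.compress_mem he.1 hzA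
    have hbI : b ∈ I := by
      have : b = star z * z - e * (star z * z) - (star z * z * e - e * (star z * z) * e) := by
        rw [hb]; noncomm_ring
      rw [this]
      have h1 := hI.mul_left e (hAC e he.1) _ hzz
      exact I.sub_mem (I.sub_mem hzz h1) (I.sub_mem (hI.mul_right e (hAC e he.1) _ hzz)
        (hI.mul_right e (hAC e he.1) _ h1))
    have heb : e * b = 0 := by
      rw [hb, mul_assoc, ← mul_assoc, he.2.mul_one_sub_self, zero_mul]
    have hbe : b * e = 0 := by rw [hb, mul_assoc, he.2.one_sub_mul_self, mul_zero]
    obtain ⟨q, hq, hq0, -, hqcl⟩ := hA.exists_projection (S := {e, b}) (b := b)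
      (by rintro x (rfl | rfl); exacts [he.1, hbA])
      (Set.pairwise_pair.2 fun _ => ⟨heb.trans hbe.symm, hbe.trans heb.symm⟩) (by simp) hb0
    refine hq0 (hmax q ⟨?_, hq⟩ ?_)
    · refine closure_minimal ?_ hI.isClosed hqcl
      rintro _ ⟨y, hy, rfl⟩
      exact hI.mul_right y (hAC y hy) b hbI
    · refine closure_minimal (t := {z | e * z = 0}) ?_
        (isClosed_eq (continuous_const_mul e) continuous_const) hqcl
      rintro _ ⟨y, -, rfl⟩
      change e * (b * y) = 0
      rw [← mul_assoc, heb, zero_mul]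
  have hz' : ∀ z ∈ I, (1 - e) * z = 0 := fun z hzI => by
    have := congrArg star (hz _ (hstar z hzI))
    rwa [star_mul, star_star, hvsa, star_zero] at this
  have hann : ∀ x ∈ posCone A, (∀ p ∈ T, x * p = 0) → x * e = 0 := fun x hx hxT =>
    hA.mul_sup_eq_zero hTA hcomm he hub hlub hx.1 hx.2 hxT
  refine ⟨e, ⟨he, fun a ha => ?_⟩, fun z hzI => ⟨?_, ?_⟩, fun x hx hxp => ?_⟩
  · have hasa := (hA.isSelfAdjoint a ha).star_eq
    -- Centrality amounts to `w = 0`. For `p ∈ T`, `ap ∈ I` is killed by `1 - e`, so `w * p = 0`;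
    -- the positive element `star w * w` of `A` thus annihilates `T`, hence `e`.
    set w := (1 - e) * a * e with hw
    have hww : star w * w = e * (a * a - a * e * a) * e := by
      rw [hw, star_mul, star_mul, hasa, hesa, hvsa]
      calc e * (a * (1 - e)) * ((1 - e) * a * e)
          = e * (a * ((1 - e) * (1 - e)) * a) * e := by simp only [mul_assoc]
        _ = _ := by rw [he.2.one_sub.isIdempotentElem.eq, mul_sub, mul_one, sub_mul]
    have hwA : star w * w ∈ A := by
      rw [hww]
      exact hA.mul_mul_mem he.1 (A.sub_mem (hA.mul_self_mem ha) (hA.mul_mul_mem ha he.1))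
    have hwe := hann (star w * w) ⟨hwA, star_mul_self_nonneg w⟩ fun p hp => by
      have hwp : w * p = 0 := by
        rw [hw, mul_assoc, mul_eq_right_of_mul_eq_left (hTA hp).2 he.2 (hub p hp), mul_assoc,
          hz' _ (hI.mul_left a (hAC a ha) p (hTQ hp).1)]
      rw [mul_assoc, hwp, mul_zero]
    have hw0 : w = 0 := by
      rw [← CStarRing.star_mul_self_eq_zero_iff, ← hwe, mul_assoc, hw, mul_assoc _ e e,
        he.2.isIdempotentElem.eq]
    have h1 : a * e = e * a * e := by
      rw [hw, sub_mul, one_mul, sub_mul, sub_eq_zero] at hw0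
      exact hw0
    have h2 : e * a = e * a * e := by
      have := congrArg star h1
      rwa [star_mul, star_mul, star_mul, hasa, hesa, ← mul_assoc] at this
    exact h2.trans h1.symm
  · have := hz' z hzI
    rw [sub_mul, one_mul, sub_eq_zero] at this
    exact this.symm
  · have := hz z hzI
    rw [mul_sub, mul_one, sub_eq_zero] at this
    exact this.symm
  · exact hann x hx fun p hp => hxp p ⟨(hTQ hp).1, (hTA hp).2.isSelfAdjoint⟩

/-- An operator annihilating `S` on both sides annihilates `R*(S)` on the left. -/
theorem mul_eq_zero_of_mem_realStarAlg {S : Set (H →L[ℂ] H)} {e : H →L[ℂ] H}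
    (he : IsSelfAdjoint e) (hS : ∀ a ∈ S, e * a = 0 ∧ a * e = 0) {z : H →L[ℂ] H}
    (hz : z ∈ realStarAlg S) : e * z = 0 := by
  have hadj : ∀ x ∈ NonUnitalStarAlgebra.adjoin ℝ S, e * x = 0 ∧ x * e = 0 := by
    intro x hx
    induction hx using NonUnitalStarAlgebra.adjoin_induction with
    | mem a ha => exact hS a ha
    | add y z _ _ h1 h2 =>
      rw [mul_add, add_mul, h1.1, h1.2, h2.1, h2.2]
      simp
    | zero => simp
    | mul y z _ _ h1 h2 =>
      rw [← mul_assoc, h1.1, mul_assoc, h2.2]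
      simp
    | smul r y _ h =>
      rw [mul_smul_comm, smul_mul_assoc, h.1, h.2]
      simp
    | star y _ h =>
      refine ⟨?_, ?_⟩
      · simpa [he.star_eq] using congrArg star h.2
      · simpa [he.star_eq] using congrArg star h.1
  exact closure_minimal (t := {x | e * x = 0}) (fun x hx => (hadj x hx).1)
    (isClosed_eq (continuous_const_mul e) continuous_const) hz

end JordanOp

/-! ### The decomposition of the unit. -/

open JordanOp in
theorem lemma2p5 {H : Type*} [NormedAddCommGroup H] [InnerProductSpace ℂ H] [CompleteSpace H]
    (A : Submodule ℝ (H →L[ℂ] H)) (hA : IsAJWAlgebra A) (hrev : IsReversible A) :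
    ∃ (e f : H →L[ℂ] H) (I : Submodule ℂ (H →L[ℂ] H)),
      IsCentralProjection A e ∧ IsCentralProjection A f ∧ IsJordanUnit A (e + f) ∧
      (I : Set (H →L[ℂ] H)) = realInterI (A : Set (H →L[ℂ] H)) ∧
      IsClosedTwoSidedIdeal (cStarAlg (A : Set (H →L[ℂ] H))) I ∧
      saPart (I : Set (H →L[ℂ] H)) ⊆ A ∧
      (fun a => e * a) '' posCone A = perpPos A (perpPos A (saPart (I : Set (H →L[ℂ] H)))) ∧
      realInterI ((fun a => f * a) '' (A : Set (H →L[ℂ] H))) = {0} := by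
  set I := realInterISubmodule (A : Set (H →L[ℂ] H))
  have hI := isClosedTwoSidedIdeal_realInterISubmodule (A : Set (H →L[ℂ] H))
  have hsa : saPart (I : Set (H →L[ℂ] H)) ⊆ A := fun x hx =>
    hrev.mem_of_mem_realStarAlg hA.toIsJCAlgebra (mem_realInterISubmodule.1 hx.1).1 hx.2
  obtain ⟨e, he, heI, hann⟩ :=
    hA.exists_central_cover hI (fun z hz => star_mem_realInterISubmodule hz) hsa
  obtain ⟨u, hu, hunit⟩ := hA.exists_unit
  have hee := he.1.2.isIdempotentElem.eq
  have hesa := he.1.2.isSelfAdjoint.star_eq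
  have huc : ∀ a ∈ A, Commute u a := fun a ha => (hunit a ha).1.trans (hunit a ha).2.symm
  have hue : u * e = e := (hunit e he.1.1).1
  have hfe : (u - e) * e = 0 := by rw [sub_mul, hue, hee, sub_self]
  have hef : e * (u - e) = 0 := by rw [mul_sub, (hunit e he.1.1).2, hee, sub_self]
  have hfA : u - e ∈ A := A.sub_mem hu.1 he.1.1
  have hf : IsCentralProjection A (u - e) := by
    have h := isStarProjection_sub_mul hu.2 he.1.2 (huc e he.1.1)
    rw [hue] at h
    exact ⟨⟨hfA, h⟩, fun a ha => (huc a ha).sub_left (he.2 a ha)⟩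
  have hperp : ∀ x, x ∈ perpPos A (saPart (I : Set (H →L[ℂ] H))) ↔ x ∈ posCone A ∧ x * e = 0 := by
    refine fun x => and_congr_right fun hx => ⟨fun h => hann x hx fun p hp => ?_, fun h a ha => ?_⟩
    · refine mul_eq_zero_of_star_mul_mul hx.2 ?_
      rw [hp.2.star_eq, ← jU_eq]
      exact h p hp
    · rw [jU_eq, mul_assoc, ← (heI a ha.1).1, ← mul_assoc x, h, zero_mul, mul_zero]
  refine ⟨e, u - e, I, he, hf, ?_, rfl, hI, hsa, ?_, ?_⟩
  · rw [add_sub_cancel]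
    exact ⟨hu.1, fun a ha => (jmul_eq_mul (huc a ha)).trans (hunit a ha).1⟩
  · ext y
    constructor
    · rintro ⟨a, ha, rfl⟩
      have hea : e * a = e * a * e := by
        rw [mul_assoc, ← (he.2 a ha.1).eq, ← mul_assoc, hee]
      refine ⟨⟨?_, ?_⟩, fun x hx => ?_⟩
      · change e * a ∈ A
        rw [hea]
        exact hA.mul_mul_mem he.1.1 ha.1
      · change 0 ≤ e * a
        rw [hea]
        simpa [hesa] using star_left_conjugate_nonneg ha.2 e
      · rw [jU_eq, ← mul_assoc, ((hperp x).1 hx).2, zero_mul, zero_mul]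
    · rintro ⟨hy, h⟩
      refine ⟨y, hy, ?_⟩
      -- The projection `f = u - e` itself lies in the first annihilator, and testing against it
      -- alone forces `y * f = 0`.
      have hfy := h (u - e) ((hperp _).2 ⟨⟨hfA, hf.1.2.nonneg⟩, hfe⟩)
      have hyf : y * (u - e) = 0 := by
        refine mul_eq_zero_of_star_mul_mul hy.2 ?_
        rw [hf.1.2.isSelfAdjoint.star_eq, ← jU_eq]
        exact hfy
      rw [mul_sub, (hunit y hy.1).2, sub_eq_zero] at hyf
      exact (he.2 y hy.1).eq.trans hyf.symm
  · have hsub : (fun a => (u - e) * a) '' (A : Set (H →L[ℂ] H)) ⊆ A := by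
      rintro _ ⟨a, ha, rfl⟩
      have : (u - e) * a = (u - e) * a * (u - e) := by
        rw [mul_assoc, ← (hf.2 a ha).eq, ← mul_assoc, hf.1.2.isIdempotentElem.eq]
      change (u - e) * a ∈ A
      rw [this]
      exact hA.mul_mul_mem hfA ha
    have hmono : realStarAlg ((fun a => (u - e) * a) '' (A : Set (H →L[ℂ] H)))
        ≤ realStarAlg (A : Set (H →L[ℂ] H)) :=
      NonUnitalStarSubalgebra.topologicalClosure_mono (NonUnitalStarAlgebra.adjoin_mono hsub)
    refine Set.Subset.antisymm (fun z hz => ?_) ?_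
    · rw [mem_realInterI] at hz
      -- As an element of `I`, `z` is fixed by `e`; as an element of `R*(fA)`, it is killed by `e`.
      have hzI : z ∈ I := mem_realInterISubmodule.2 ⟨hmono hz.1, hmono hz.2⟩
      have h0 : e * z = 0 := by
        refine mul_eq_zero_of_mem_realStarAlg he.1.2.isSelfAdjoint ?_ hz.1
        rintro _ ⟨a, ha, rfl⟩
        refine ⟨?_, ?_⟩
        · change e * ((u - e) * a) = 0
          rw [← mul_assoc, hef, zero_mul]
        · change (u - e) * a * e = 0
          rw [mul_assoc, ← (he.2 a ha).eq, ← mul_assoc, hfe, zero_mul]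
      rw [Set.mem_singleton_iff, ← (heI z hzI).1, h0]
    · rintro _ rfl
      exact (realInterISubmodule _).zero_mem
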